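/- Let $m,d$ be integers with $2\le d<m\le 2d-1$, put $r=m-d$, and let $S_j(x)=\frac xd+\frac jd\cdot\frac{d-1}{m-1}$ for $j=0,1,\dots,m-1$. For a word $\sigma=(\sigma_1,\dots,\sigma_n)\in\{0,\dots,m-1\}^n$ let $S_\sigma=S_{\sigma_1}\circ\dots\circ S_{\sigma_n}$. The nodes at level $n\ge 0$ of the $(m,d)$-graph are the distinct points $S_\sigma(0)$ with $|\sigma|=n$; denote the set of them by $g_n$. With uniform probabilities, a node $z\in g_n$ has weight $w_z=m^{-n}\,\#\{\sigma : |\sigma|=n,\ S_\sigma(0)=z\}$, and the entropy of level $n$ is $h_{m,d}(n)=-\sum_{z\in g_n} w_z\log_2 w_z$. Let $H_{m,d}(x)=\sum_{n\ge 0}h_{m,d}(n)x^n$ (note that $h_{m,d}(0)=0$). For coprime positive integers $k>i$ let $e(k,i)$ be the number of steps of the simple Euclidean algorithm (repeatedly subtract the smaller number from the larger one) that reduce $\{k,i\}$ to $\{1,1\}$. Define real numbers $\ell(n)$ by the identity of formal power series $$\sum_{n\ge 1}\ell(n)x^n=(1-3x)^2\sum_{n\ge 1}x^n\sum_{\substack{k>i\ge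 1,\ \gcd(i,k)=1\\ e(k,i)=n}}k\log_2 k .$$ Then the power series $L(x)=\sum_{n\ge1}\ell(n)x^n$ converges for all complex $x$ with $|x|<1$. With $$R(x)=\frac{r(m-1)m}{(m-x)^2},\qquad T_{m,d}(x)=\log_2 m-R(x)\,L\!\left(\frac xm\right),$$ the function $T_{m,d}$ is analytic on the disk $|x|<m$, and for all complex $x$ with $|x|<1$ the series $H_{m,d}(x)$ converges and $$H_{m,d}(x)=\frac{x}{(x-1)^2}\,T_{m,d}(x).$$ -/

import Mathlib

namespace CantorLike

noncomputable section

open Finset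

/-- The contraction `S_j(x) = x/d + (j/d) · (d-1)/(m-1)`, for `j = 0, …, m-1`. -/
def contraction (m d : ℕ) (j : Fin m) (x : ℝ) : ℝ :=
  x / d + ((j : ℕ) : ℝ) / d * (((d : ℝ) - 1) / ((m : ℝ) - 1))

/-- `S_σ = S_{σ₁} ∘ ⋯ ∘ S_{σₙ}` for a word `σ` of length `n` over `{0, …, m-1}`. -/
def wordMap (m d : ℕ) : (n : ℕ) → (Fin n → Fin m) → ℝ → ℝ
  | 0, _ => id
  | n + 1, σ => contraction m d (σ 0) ∘ wordMap m d n (fun i => σ i.succ)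

open Classical in
/-- `g_n`: the nodes at level `n` of the `(m,d)`-graph, i.e. the distinct points `S_σ(0)`
with `|σ| = n`. -/
def nodes (m d n : ℕ) : Finset ℝ :=
  univ.image fun σ : Fin n → Fin m => wordMap m d n σ 0

open Classical in
/-- `[z]_n`: the words `σ` of length `n` with `S_σ(0) = z`. -/
def wordsTo (m d n : ℕ) (z : ℝ) : Finset (Fin n → Fin m) :=
  univ.filter fun σ => wordMap m d n σ 0 = z

/-- `w_z = ∑_{σ ∈ [z]_n} p_σ`, where `p_σ = p_{σ₁} ⋯ p_{σₙ}`. -/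
def weight (m d : ℕ) (p : Fin m → ℝ) (n : ℕ) (z : ℝ) : ℝ :=
  ∑ σ ∈ wordsTo m d n z, ∏ i, p (σ i)

/-- The entropy of level `n` of the `(m,d)`-graph weighted by `p`. Every node of the level
contributes, also when several nodes have the same weight. -/
def levelEntropy (m d : ℕ) (p : Fin m → ℝ) (n : ℕ) : ℝ :=
  -∑ z ∈ nodes m d n, weight m d p n z * Real.logb 2 (weight m d p n z)

/-- `h_{m,d}(n)`: the level entropy for the uniform probabilities `p_j = 1/m`. -/
def uniformLevelEntropy (m d n : ℕ) : ℝ :=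
  levelEntropy m d (fun _ => 1 / (m : ℝ)) n

/-- The number of steps of the simple (repeated subtraction) Euclidean algorithm that reduce
the pair `{a, b}` of positive integers to the pair `{g, g}`, where `g` is their gcd.
(The value is `0` if one of the numbers is `0`.) -/
def euclidSteps (a b : ℕ) : ℕ :=
  if a = 0 ∨ b = 0 ∨ a = b then 0
  else if a < b then euclidSteps a (b - a) + 1
  else euclidSteps (a - b) b + 1
termination_by a + b
decreasing_by all_goals omega

/-- The pairs `(k, i)` of coprime positive integers with `k > i` and `e(k, i) = n`. -/
def euclidPairs (n : ℕ) : Set (ℕ × ℕ) :=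
  {q | 0 < q.2 ∧ q.2 < q.1 ∧ Nat.gcd q.2 q.1 = 1 ∧ euclidSteps q.1 q.2 = n}

theorem add_le_of_euclidSteps (n : ℕ) : ∀ a b : ℕ, 0 < a → 0 < b → Nat.gcd a b = 1 →
    euclidSteps a b = n → a + b ≤ 2 ^ (n + 1) := by
  induction n with
  | zero =>
    intro a b ha hb hg he
    rw [euclidSteps] at he
    split_ifs at he with h1
    · rcases h1 with h | h | h
      · omega
      · omega
      · subst h
        simp at hg
        omega
  | succ n ih =>
    intro a b ha hb hg he
    rw [euclidSteps] at he
    split_ifs at he with h1 h2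
    · have := ih a (b - a) ha (by omega) (by rwa [Nat.gcd_sub_self_right h2.le]) (by omega)
      rw [pow_succ]
      omega
    · have := ih (a - b) b (by omega) hb
        (by rwa [Nat.gcd_sub_self_left (by omega)]) (by omega)
      rw [pow_succ]
      omega

theorem euclidPairs_finite (n : ℕ) : (euclidPairs n).Finite := by
  refine (Set.finite_Iic ((2 ^ (n + 1), 2 ^ (n + 1)) : ℕ × ℕ)).subset ?_
  rintro ⟨k, i⟩ ⟨h0, h1, h2, h3⟩
  have := add_le_of_euclidSteps n k i (h0.trans h1) h0 (by rwa [Nat.gcd_comm]) h3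
  exact ⟨by simp only; omega, by simp only; omega⟩

/-- `∑ k log₂ k` over the coprime pairs `k > i ≥ 1` with `e(k, i) = n`. -/
def euclidSum (n : ℕ) : ℝ :=
  ∑ q ∈ (euclidPairs_finite n).toFinset, (q.1 : ℝ) * Real.logb 2 (q.1 : ℝ)

/-- `ℓ(n)`: the coefficient of `X^n` in `(1 - 3X)² · ∑_{n ≥ 1} euclidSum(n) X^n`
(the term `n = 0` of the sum vanishes, as there is no pair `k > i` with `e(k, i) = 0`). -/
def ell (n : ℕ) : ℝ :=
  PowerSeries.coeff n ((1 - 3 * PowerSeries.X) ^ 2 * PowerSeries.mk euclidSum)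

/-- `L(x) = ∑ ℓ(n) xⁿ`. -/
def L (x : ℂ) : ℂ := ∑' n : ℕ, (ell n : ℂ) * x ^ n

/-- `R(x) = r(m-1)m / (m-x)²`, where `r = m - d`. -/
def R (m d : ℕ) (x : ℂ) : ℂ :=
  ((m : ℂ) - d) * ((m : ℂ) - 1) * m / ((m : ℂ) - x) ^ 2

/-- `T_{m,d}(x) = log₂ m - R(x) L(x/m)`. -/
def T (m d : ℕ) (x : ℂ) : ℂ :=
  (Real.logb 2 (m : ℝ) : ℂ) - R m d x * L (x / m)

end

end CantorLike

namespace CantorLike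

noncomputable section

open Finset

/-! Up to a common scale, the nodes of level `n` are the integers with an `n`-digit base-`d`
expansion over the digits `0, …, m - 1`, so the entropy is `n log₂ m` minus `m⁻ⁿ ∑ a log₂ a` over
the representation counts `a`. If `(u, v)` are the counts of `q` and `q - 1`, the block of `d`
integers below `q` on the next level produces the consecutive pairs `(u + v, v)`, `(u, u + v)`, and
otherwise only diagonal ones (`pairSum_succ`).

The two off-diagonal pairs are dual to one step up the subtractive Euclidean tree. Summing `(su +
tv) log₂ (su + tv)` over tree level `e` therefore trades a digit level for a tree level, with an
explicit diagonal error (`treePairEntropy_succ`). Unrolled to digit level `0`, this is a convolution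
equation whose data are the Euclidean sums. It is solved by generating functions in
`mk_countEntropy_eq_mk_ell`, where the factor `(1 - 3X)²` appears.

Convergence comes from boundedness of `ell` (`exists_abs_ell_le`): tree sums of homogeneous
subadditive functions grow at least by the factor `3` per level, which forces `ell (n + 3)` to be a
nonnegative difference of consecutive terms of a nonnegative sequence. -/

/-- `x log₂ x`. -/
def xlog (x : ℝ) : ℝ := x * Real.logb 2 x

@[simp] theorem xlog_zero : xlog 0 = 0 := by simp [xlog]

@[simp] theorem xlog_one : xlog 1 = 0 := by simp [xlog]

theorem xlog_mul (a b : ℝ) : xlog (a * b) = a * xlog b + b * xlog a := by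
  unfold xlog
  rcases eq_or_ne a 0 with rfl | ha
  · simp
  rcases eq_or_ne b 0 with rfl | hb
  · simp
  rw [Real.logb_mul ha hb]
  ring

/-- The log-sum inequality for two summands. -/
theorem mul_logb_div_add_le {a b a' b' : ℝ} (ha : 0 < a) (hb : 0 < b) (ha' : 0 < a')
    (hb' : 0 < b') :
    (a + a') * (Real.logb 2 (a + a') - Real.logb 2 (b + b')) ≤
      a * (Real.logb 2 a - Real.logb 2 b) + a' * (Real.logb 2 a' - Real.logb 2 b') := by
  -- This is `log z ≤ z - 1` at `z = y (a + a') / ((b + b') x)`. Over the two pairs the left sides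
  -- add up to zero.
  have key : ∀ x y : ℝ, 0 < x → 0 < y →
      x - y * (a + a') / (b + b') ≤
        x * (Real.log x - Real.log y) - x * (Real.log (a + a') - Real.log (b + b')) := by
    intro x y hx hy
    have h := Real.log_le_sub_one_of_pos (x := y * (a + a') / (b + b') / x) (by positivity)
    rw [Real.log_div (by positivity) hx.ne', Real.log_div (by positivity) (by positivity),
      Real.log_mul hy.ne' (by positivity)] at h
    have h2 := mul_le_mul_of_nonneg_left h hx.le
    have h3 : x * (y * (a + a') / (b + b') / x - 1) = y * (a + a') / (b + b') - x := by
      field_simp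
    rw [h3] at h2
    linarith
  have h1 := key a b ha hb
  have h2 := key a' b' ha' hb'
  have h3 : b * (a + a') / (b + b') + b' * (a + a') / (b + b') = a + a' := by
    field_simp
  have h4 : (a + a') * (Real.log (a + a') - Real.log (b + b')) ≤
      a * (Real.log a - Real.log b) + a' * (Real.log a' - Real.log b') := by linarith
  have h5 := div_le_div_of_nonneg_right h4 (Real.log_pos one_lt_two).le
  have e : ∀ x y z : ℝ, x * (Real.logb 2 y - Real.logb 2 z) =
      x * (Real.log y - Real.log z) / Real.log 2 := by
    intro x y z
    simp only [Real.logb]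
    ring
  rw [e, e, e, ← add_div]
  exact h5

/-! ### The tree of coprime pairs -/

/-- The ordered pairs of coprime positive integers that the subtractive Euclidean algorithm
reduces to `(1, 1)` in `e` steps. -/
def coprimePairs (e : ℕ) : Finset (ℕ × ℕ) :=
  (range (2 ^ (e + 1)) ×ˢ range (2 ^ (e + 1))).filter fun q =>
    0 < q.1 ∧ 0 < q.2 ∧ Nat.gcd q.1 q.2 = 1 ∧ euclidSteps q.1 q.2 = e

theorem mem_coprimePairs {e : ℕ} {q : ℕ × ℕ} : q ∈ coprimePairs e ↔
    0 < q.1 ∧ 0 < q.2 ∧ Nat.gcd q.1 q.2 = 1 ∧ euclidSteps q.1 q.2 = e := by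
  simp only [coprimePairs, mem_filter, mem_product, mem_range, and_iff_right_iff_imp]
  rintro ⟨h1, h2, h3, h4⟩
  have := add_le_of_euclidSteps e _ _ h1 h2 h3 h4
  omega

theorem euclidSteps_add_left {s t : ℕ} (hs : 0 < s) (ht : 0 < t) :
    euclidSteps (s + t) t = euclidSteps s t + 1 := by
  rw [euclidSteps, if_neg (by omega), if_neg (by omega), Nat.add_sub_cancel]

theorem euclidSteps_add_right {s t : ℕ} (hs : 0 < s) (ht : 0 < t) :
    euclidSteps s (s + t) = euclidSteps s t + 1 := by
  rw [euclidSteps, if_neg (by omega), if_pos (by omega), Nat.add_sub_cancel_left]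

theorem coprimePairs_zero : coprimePairs 0 = {(1, 1)} := by
  ext ⟨s, t⟩
  rw [mem_coprimePairs, mem_singleton, Prod.mk.injEq]
  constructor
  · rintro ⟨h1, h2, h3, h4⟩
    have := add_le_of_euclidSteps 0 _ _ h1 h2 h3 h4
    simp only at *
    omega
  · rintro ⟨rfl, rfl⟩
    simp [euclidSteps]

/-- The sum of `F` over the ordered coprime pairs of Euclidean depth `e`. -/
def treeSum (e : ℕ) (F : ℕ → ℕ → ℝ) : ℝ := ∑ q ∈ coprimePairs e, F q.1 q.2

/-- The sum of `F` over the two children of a pair. -/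
def branch (F : ℕ → ℕ → ℝ) (s t : ℕ) : ℝ := F s (s + t) + F (s + t) t

theorem sum_filter_gt_coprimePairs (e : ℕ) (F : ℕ → ℕ → ℝ) :
    ∑ q ∈ (coprimePairs (e + 1)).filter (fun q => q.2 < q.1), F q.1 q.2 =
      treeSum e fun s t => F (s + t) t := by
  refine sum_nbij' (fun q => (q.1 - q.2, q.2)) (fun q => (q.1 + q.2, q.2)) ?_ ?_ ?_ ?_ ?_
  · rintro ⟨s, t⟩ h
    simp only [mem_filter, mem_coprimePairs] at h ⊢
    obtain ⟨⟨h1, h2, h3, h4⟩, h5⟩ := h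
    obtain ⟨u, rfl⟩ := Nat.exists_eq_add_of_lt h5
    have hu : t + u + 1 = (u + 1) + t := by ring
    rw [hu] at h3 h4 ⊢
    rw [euclidSteps_add_left (by omega) h2] at h4
    rw [Nat.add_sub_cancel]
    refine ⟨by omega, h2, by simpa using h3, by omega⟩
  · rintro ⟨s, t⟩ h
    simp only [mem_filter, mem_coprimePairs] at h ⊢
    obtain ⟨h1, h2, h3, h4⟩ := h
    exact ⟨⟨by omega, h2, by simpa using h3, by rw [euclidSteps_add_left h1 h2, h4]⟩, by omega⟩
  · rintro ⟨s, t⟩ h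
    simp only [mem_filter] at h
    simp [Nat.sub_add_cancel h.2.le]
  · rintro ⟨s, t⟩ h
    simp
  · rintro ⟨s, t⟩ h
    simp only [mem_filter] at h
    simp [Nat.sub_add_cancel h.2.le]

theorem sum_filter_lt_coprimePairs (e : ℕ) (F : ℕ → ℕ → ℝ) :
    ∑ q ∈ (coprimePairs (e + 1)).filter (fun q => ¬ q.2 < q.1), F q.1 q.2 =
      treeSum e fun s t => F s (s + t) := by
  have hlt : ∀ q ∈ (coprimePairs (e + 1)).filter (fun q => ¬ q.2 < q.1), q.1 < q.2 := by
    rintro ⟨s, t⟩ h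
    simp only [mem_filter, mem_coprimePairs] at h ⊢
    obtain ⟨⟨h1, h2, h3, h4⟩, h5⟩ := h
    rcases (not_lt.1 h5).lt_or_eq with h | rfl
    · exact h
    · simp [euclidSteps] at h4
  refine sum_nbij' (fun q => (q.1, q.2 - q.1)) (fun q => (q.1, q.1 + q.2)) ?_ ?_ ?_ ?_ ?_
  · rintro ⟨s, t⟩ h
    have h5 := hlt _ h
    simp only [mem_filter, mem_coprimePairs] at h h5 ⊢
    obtain ⟨⟨h1, h2, h3, h4⟩, -⟩ := h
    obtain ⟨u, rfl⟩ := Nat.exists_eq_add_of_lt h5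
    rw [add_assoc] at h3 h4 ⊢
    rw [euclidSteps_add_right h1 (by omega)] at h4
    rw [Nat.add_sub_cancel_left]
    refine ⟨h1, by omega, by simpa using h3, by omega⟩
  · rintro ⟨s, t⟩ h
    simp only [mem_filter, mem_coprimePairs] at h ⊢
    obtain ⟨h1, h2, h3, h4⟩ := h
    exact ⟨⟨h1, by omega, by simpa using h3, by rw [euclidSteps_add_right h1 h2, h4]⟩, by omega⟩
  · rintro ⟨s, t⟩ h
    have := hlt _ h
    simp only at this
    simp [Nat.add_sub_cancel' this.le]
  · rintro ⟨s, t⟩ h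
    simp
  · rintro ⟨s, t⟩ h
    have := hlt _ h
    simp only at this
    simp [Nat.add_sub_cancel' this.le]

theorem treeSum_zero (F : ℕ → ℕ → ℝ) : treeSum 0 F = F 1 1 := by
  simp [treeSum, coprimePairs_zero]

theorem treeSum_add (e : ℕ) (F G : ℕ → ℕ → ℝ) :
    treeSum e (fun s t => F s t + G s t) = treeSum e F + treeSum e G := sum_add_distrib

theorem treeSum_sub (e : ℕ) (F G : ℕ → ℕ → ℝ) :
    treeSum e (fun s t => F s t - G s t) = treeSum e F - treeSum e G := sum_sub_distrib ..

theorem treeSum_mul_left (e : ℕ) (c : ℝ) (F : ℕ → ℕ → ℝ) :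
    treeSum e (fun s t => c * F s t) = c * treeSum e F := (mul_sum ..).symm

/-- Undoing one subtraction turns `(s, t)` into `(s + t, t)` or `(s, s + t)`; which component is
larger tells the two apart. -/
theorem treeSum_succ (e : ℕ) (F : ℕ → ℕ → ℝ) : treeSum (e + 1) F = treeSum e (branch F) := by
  rw [treeSum, ← sum_filter_add_sum_filter_not _ (fun q : ℕ × ℕ => q.2 < q.1),
    sum_filter_gt_coprimePairs, sum_filter_lt_coprimePairs, add_comm, ← treeSum_add]
  rfl

theorem treeSum_eq_iterate (e : ℕ) (F : ℕ → ℕ → ℝ) : treeSum e F = branch^[e] F 1 1 := by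
  induction e generalizing F with
  | zero => exact treeSum_zero F
  | succ e ih => rw [treeSum_succ, ih, Function.iterate_succ_apply]

theorem euclidSum_zero : euclidSum 0 = 0 := by
  refine sum_eq_zero ?_
  rintro ⟨k, i⟩ h
  simp only [Set.Finite.mem_toFinset, euclidPairs, Set.mem_ofPred_eq] at h
  obtain ⟨h1, h2, h3, h4⟩ := h
  have := add_le_of_euclidSteps 0 k i (by omega) h1 (by rwa [Nat.gcd_comm]) h4
  omega

theorem euclidSum_succ (e : ℕ) :
    euclidSum (e + 1) = treeSum e fun s t => xlog ((s : ℝ) + t) := by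
  have h := sum_filter_gt_coprimePairs e fun s _ => xlog s
  simp only [Nat.cast_add] at h
  rw [← h]
  refine sum_congr ?_ fun _ _ => rfl
  ext ⟨k, i⟩
  simp only [Set.Finite.mem_toFinset, euclidPairs, Set.mem_ofPred_eq, mem_filter, mem_coprimePairs]
  constructor
  · rintro ⟨h1, h2, h3, h4⟩
    exact ⟨⟨h1.trans h2, h1, by rwa [Nat.gcd_comm], h4⟩, h2⟩
  · rintro ⟨⟨-, h1, h3, h4⟩, h2⟩
    exact ⟨h1, h2, by rwa [Nat.gcd_comm], h4⟩

theorem treeSum_fst_add_snd (e : ℕ) : treeSum e (fun s t => (s : ℝ) + t) = 2 * 3 ^ e := by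
  induction e with
  | zero => rw [treeSum_zero]; norm_num
  | succ e ih =>
    rw [treeSum_succ, pow_succ, ← mul_assoc, ← ih, mul_comm, ← treeSum_mul_left]
    congr 1
    ext s t
    simp only [branch, Nat.cast_add]
    ring

theorem treeSum_xlog_fst_succ (e : ℕ) :
    treeSum (e + 1) (fun s _ => xlog s) = treeSum e (fun s _ => xlog s) + euclidSum (e + 1) := by
  rw [treeSum_succ, euclidSum_succ, ← treeSum_add]
  congr 1
  ext s t
  simp only [branch, Nat.cast_add]

theorem treeSum_xlog_snd_succ (e : ℕ) :
    treeSum (e + 1) (fun _ t => xlog t) = treeSum e (fun _ t => xlog t) + euclidSum (e + 1) := by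
  rw [treeSum_succ, euclidSum_succ, ← treeSum_add]
  congr 1
  ext s t
  simp only [branch, Nat.cast_add]
  ring

/-- Each component survives in one child and is replaced by `s + t` in the other, so the sums
accumulate. This is the initial value of `treePairEntropy` at digit level `0`. -/
theorem treeSum_xlog_fst_add_snd (e : ℕ) :
    treeSum e (fun s t => xlog s + xlog t) = 2 * ∑ k ∈ range (e + 1), euclidSum k := by
  rw [treeSum_add]
  induction e with
  | zero => simp [treeSum_zero, euclidSum_zero]
  | succ e ih =>
    rw [treeSum_xlog_fst_succ, treeSum_xlog_snd_succ, sum_range_succ, mul_add, ← ih]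
    ring

/-! ### Boundedness of `ell` -/

/-- Positively homogeneous and subadditive functions on pairs of positive integers. -/
structure IsSublinear (F : ℕ → ℕ → ℝ) : Prop where
  smul : ∀ c s t, 0 < c → 0 < s → 0 < t → F (c * s) (c * t) = c * F s t
  add_le : ∀ s t s' t', 0 < s → 0 < t → 0 < s' → 0 < t' →
    F (s + s') (t + t') ≤ F s t + F s' t'

theorem IsSublinear.branch {F : ℕ → ℕ → ℝ} (hF : IsSublinear F) :
    IsSublinear (branch F) where
  smul c s t hc hs ht := by
    unfold CantorLike.branch
    rw [← mul_add, hF.smul c _ _ hc hs (by omega), hF.smul c _ _ hc (by omega) ht, mul_add]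
  add_le s t s' t' hs ht hs' ht' := by
    unfold CantorLike.branch
    have h1 := hF.add_le s (s + t) s' (s' + t') hs (by omega) hs' (by omega)
    have h2 := hF.add_le (s + t) t (s' + t') t' (by omega) ht (by omega) ht'
    rw [add_add_add_comm s s' t t']
    linarith

theorem IsSublinear.iterate_branch {F : ℕ → ℕ → ℝ} (hF : IsSublinear F) (n : ℕ) :
    IsSublinear (CantorLike.branch^[n] F) := by
  induction n with
  | zero => exact hF
  | succ n ih => rw [Function.iterate_succ_apply']; exact ih.branch

/-- `branch` preserves sublinearity, so only the root matters: `G 1 2 + G 2 1 ≥ G 3 3 = 3 * G 1 1`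
for `G = branch^[n] F`. -/
theorem IsSublinear.three_mul_treeSum_le {F : ℕ → ℕ → ℝ} (hF : IsSublinear F) (n : ℕ) :
    3 * treeSum n F ≤ treeSum (n + 1) F := by
  have h := hF.iterate_branch n
  have h1 := h.add_le 1 2 2 1 (by norm_num) (by norm_num) (by norm_num) (by norm_num)
  have h2 := h.smul 3 1 1 (by norm_num) (by norm_num) (by norm_num)
  rw [treeSum_eq_iterate, treeSum_eq_iterate, Function.iterate_succ_apply', CantorLike.branch]
  norm_num at h1 h2 ⊢
  linarith

theorem IsSublinear.add {F G : ℕ → ℕ → ℝ} (hF : IsSublinear F) (hG : IsSublinear G) :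
    IsSublinear (fun s t => F s t + G s t) where
  smul c s t hc hs ht := by
    rw [hF.smul c s t hc hs ht, hG.smul c s t hc hs ht, mul_add]
  add_le s t s' t' hs ht hs' ht' := by
    have h1 := hF.add_le s t s' t' hs ht hs' ht'
    have h2 := hG.add_le s t s' t' hs ht hs' ht'
    linarith

/-- Relative entropy of two linear forms. -/
theorem isSublinear_relEntropy {a b a' b' : ℕ} (h : 0 < a + b) (h' : 0 < a' + b') :
    IsSublinear fun s t => ((a : ℝ) * s + b * t) *
      (Real.logb 2 ((a : ℝ) * s + b * t) - Real.logb 2 ((a' : ℝ) * s + b' * t)) := by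
  have pos : ∀ {a b s t : ℕ}, 0 < a + b → 0 < s → 0 < t → (0 : ℝ) < (a : ℝ) * s + b * t := by
    intro a b s t h hs ht
    have : 0 < a * s + b * t := by
      rcases Nat.eq_zero_or_pos a with rfl | ha
      · have : 0 < b := by omega
        positivity
      · positivity
    exact_mod_cast this
  constructor
  · intro c s t hc hs ht
    have h1 := pos h hs ht
    have h2 := pos h' hs ht
    have hc' : (0 : ℝ) < c := by exact_mod_cast hc
    have e : ∀ x y : ℝ, x * ((c * s : ℕ) : ℝ) + y * ((c * t : ℕ) : ℝ) = c * (x * s + y * t) := by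
      intro x y
      push_cast
      ring
    simp only [e]
    rw [Real.logb_mul hc'.ne' h1.ne', Real.logb_mul hc'.ne' h2.ne']
    ring
  · intro s t s' t' hs ht hs' ht'
    have e : ∀ x y : ℝ, x * ((s + s' : ℕ) : ℝ) + y * ((t + t' : ℕ) : ℝ) =
        (x * s + y * t) + (x * s' + y * t') := by
      intro x y
      push_cast
      ring
    simp only [e]
    exact mul_logb_div_add_le (pos h hs ht) (pos h' hs ht) (pos h hs' ht') (pos h' hs' ht')

/-- `xlog s + xlog t - xlog (s + t)`. -/
def pairEntropy (s t : ℕ) : ℝ := xlog s + xlog t - xlog ((s : ℝ) + t)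

/-- `branch (xlog (s + t)) - 3 xlog (s + t)`. -/
def branchDefect (s t : ℕ) : ℝ :=
  xlog (2 * s + t) + xlog (s + 2 * t) - 3 * xlog ((s : ℝ) + t)

/-- It equals `s log₂ (s/(s+t)) + t log₂ (t/(s+t))`, a sum of two relative entropies. `branchDefect`
decomposes likewise, with numerators `2s + t` and `s + 2t`. -/
theorem isSublinear_pairEntropy : IsSublinear pairEntropy := by
  have h := (isSublinear_relEntropy (a := 1) (b := 0) (a' := 1) (b' := 1)
    (by norm_num) (by norm_num)).add
    (isSublinear_relEntropy (a := 0) (b := 1) (a' := 1) (b' := 1) (by norm_num) (by norm_num))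
  convert h using 3 with s t
  simp only [pairEntropy, xlog, Nat.cast_one, Nat.cast_zero, one_mul, zero_mul, add_zero, zero_add]
  ring

theorem isSublinear_branchDefect : IsSublinear branchDefect := by
  have h := (isSublinear_relEntropy (a := 2) (b := 1) (a' := 1) (b' := 1)
    (by norm_num) (by norm_num)).add
    (isSublinear_relEntropy (a := 1) (b := 2) (a' := 1) (b' := 1) (by norm_num) (by norm_num))
  convert h using 3 with s t
  simp only [branchDefect, xlog, Nat.cast_one, Nat.cast_ofNat, one_mul]
  ring

theorem branch_pairEntropy :
    branch pairEntropy = fun s t => pairEntropy s t - branchDefect s t := by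
  ext s t
  simp only [branch, pairEntropy, branchDefect, Nat.cast_add]
  rw [show (s : ℝ) + (s + t) = 2 * s + t by ring, show (s : ℝ) + t + t = s + 2 * t by ring]
  ring

theorem treeSum_branchDefect (n : ℕ) :
    treeSum n branchDefect = treeSum n pairEntropy - treeSum (n + 1) pairEntropy := by
  rw [treeSum_succ, branch_pairEntropy, treeSum_sub]
  ring

theorem treeSum_branchDefect_eq_euclidSum (n : ℕ) :
    treeSum n branchDefect = euclidSum (n + 2) - 3 * euclidSum (n + 1) := by
  rw [euclidSum_succ (n + 1), euclidSum_succ, treeSum_succ, ← treeSum_mul_left, ← treeSum_sub]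
  congr 1
  ext s t
  simp only [branch, branchDefect, Nat.cast_add]
  rw [show (s : ℝ) + (s + t) = 2 * s + t by ring, show (s : ℝ) + t + t = s + 2 * t by ring]

theorem ell_add_three (n : ℕ) : ell (n + 3) =
    euclidSum (n + 3) - 6 * euclidSum (n + 2) + 9 * euclidSum (n + 1) := by
  have h : ((1 - 3 * PowerSeries.X) ^ 2 * PowerSeries.mk euclidSum : PowerSeries ℝ) =
      PowerSeries.mk euclidSum - PowerSeries.C 6 * (PowerSeries.mk euclidSum * PowerSeries.X) +
        PowerSeries.C 9 * (PowerSeries.mk euclidSum * PowerSeries.X * PowerSeries.X) := by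
    have h6 : (PowerSeries.C 6 : PowerSeries ℝ) = 6 := map_ofNat _ 6
    have h9 : (PowerSeries.C 9 : PowerSeries ℝ) = 9 := map_ofNat _ 9
    rw [h6, h9]
    ring
  rw [ell, h]
  simp [PowerSeries.coeff_succ_mul_X]

theorem exists_abs_ell_le : ∃ C, ∀ n, |ell n| ≤ C := by
  set b : ℕ → ℝ := fun n => treeSum (n + 1) pairEntropy - 3 * treeSum n pairEntropy with hb
  -- With `D n = treeSum n branchDefect`, `ell (n + 3) = D (n + 1) - 3 * D n`. The telescoping form
  -- of `D` gives this difference; sublinearity of `branchDefect` gives the sign in `hpos`.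
  have hell : ∀ n, ell (n + 3) = b n - b (n + 1) := by
    intro n
    have h1 := treeSum_branchDefect_eq_euclidSum n
    have h2 := treeSum_branchDefect_eq_euclidSum (n + 1)
    have h3 := treeSum_branchDefect n
    have h4 := treeSum_branchDefect (n + 1)
    simp only [hb]
    rw [ell_add_three]
    linarith
  have hpos : ∀ n, 0 ≤ ell (n + 3) := by
    intro n
    have h1 := treeSum_branchDefect_eq_euclidSum n
    have h2 := treeSum_branchDefect_eq_euclidSum (n + 1)
    have h3 := isSublinear_branchDefect.three_mul_treeSum_le n
    rw [ell_add_three]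
    linarith
  have hb0 : ∀ n, 0 ≤ b n := fun n =>
    sub_nonneg.2 (isSublinear_pairEntropy.three_mul_treeSum_le n)
  have hanti : Antitone b := antitone_nat_of_succ_le fun n => by
    have := hpos n
    rw [hell] at this
    linarith
  refine ⟨|ell 0| + |ell 1| + |ell 2| + b 0, ?_⟩
  have h0 := abs_nonneg (ell 0)
  have h1 := abs_nonneg (ell 1)
  have h2 := abs_nonneg (ell 2)
  have h3 := hb0 0
  rintro (_ | _ | _ | n)
  · linarith
  · simp only [zero_add]
    linarith
  · simp only [zero_add, Nat.reduceAdd]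
    linarith
  · rw [abs_of_nonneg (hpos n), hell]
    have := hanti (Nat.zero_le n)
    have := hb0 (n + 1)
    linarith

/-! ### Representation counts -/

/-- The sequence `f` shifted by one place, with `0` in front. -/
def prev (f : ℕ → ℕ) : ℕ → ℕ
  | 0 => 0
  | q + 1 => f q

/-- The number of expansions of `N` in base `d` with `n` digits from `{0, …, m - 1}`
(for `d < m ≤ 2 d - 1`). -/
def digitCount (m d : ℕ) : ℕ → ℕ → ℕ
  | 0, N => if N = 0 then 1 else 0
  | n + 1, N => digitCount m d n (N / d) +
      if N % d < m - d then prev (digitCount m d n) (N / d) else 0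

/-- The value of a digit string in base `d`, most significant digit first. -/
def digitValue (m d n : ℕ) (σ : Fin n → Fin m) : ℕ := ∑ i : Fin n, (σ i : ℕ) * d ^ (n - 1 - i : ℕ)

theorem digitValue_cons (m d n : ℕ) (σ : Fin (n + 1) → Fin m) :
    digitValue m d (n + 1) σ = (σ 0 : ℕ) * d ^ n + digitValue m d n fun i => σ i.succ := by
  simp only [digitValue, Fin.sum_univ_succ, Fin.val_zero, Fin.val_succ]
  congr 1
  refine sum_congr rfl fun i _ => ?_
  congr 2
  omega

theorem digitValue_snoc (m d n : ℕ) (τ : Fin n → Fin m) (j : Fin m) :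
    digitValue m d (n + 1) (Fin.snoc (α := fun _ => Fin m) τ j) = d * digitValue m d n τ + j := by
  simp only [digitValue, Fin.sum_univ_castSucc, Fin.snoc_castSucc, Fin.snoc_last, Fin.val_castSucc,
    Fin.val_last, mul_sum]
  congr 1
  · refine sum_congr rfl fun i _ => ?_
    rw [mul_left_comm, ← pow_succ']
    congr 2
    omega
  · simp

/-- The last digit is congruent to `N` mod `d` and less than `2 * d`, so it is `N % d` or `N % d +
d`. The latter borrows one from the quotient and is a digit only if `N % d < m - d`. -/
theorem card_digitValue_eq {m d : ℕ} (hd : 2 ≤ d) (hdm : d < m) (hm : m ≤ 2 * d - 1)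
    (n N : ℕ) :
    #{σ : Fin n → Fin m | digitValue m d n σ = N} = digitCount m d n N := by
  induction n generalizing N with
  | zero =>
    rcases eq_or_ne N 0 with rfl | hN
    · simp [digitCount, digitValue]
    · simp [digitCount, digitValue, hN, hN.symm]
  | succ n ih =>
    have hstep : ∀ j : ℕ, #{τ : Fin n → Fin m | d * digitValue m d n τ + j = N} =
        if j < m then (if j = N % d then digitCount m d n (N / d) else 0) +
          (if j = N % d + d then prev (digitCount m d n) (N / d) else 0) else
          #{τ : Fin n → Fin m | d * digitValue m d n τ + j = N} := by
      intro j
      split_ifs with h1 h2 h3 h3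
      · omega
      · rw [add_zero, ← ih]
        congr 1
        ext τ
        simp only [mem_filter, mem_univ, true_and]
        have hN := Nat.div_add_mod N d
        rw [h2]
        constructor
        · intro h
          exact Nat.eq_of_mul_eq_mul_left (by omega : 0 < d) (by omega)
        · rintro h
          rw [h]
          exact hN
      · rw [zero_add]
        have hN := Nat.div_add_mod N d
        rcases hq : N / d with _ | q
        · rw [prev, card_eq_zero, filter_eq_empty_iff]
          intro τ _ h
          rw [hq, mul_zero] at hN
          omega
        · rw [prev, ← ih]
          congr 1
          ext τ
          simp only [mem_filter, mem_univ, true_and]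
          rw [hq, mul_add] at hN
          constructor
          · intro h
            exact Nat.eq_of_mul_eq_mul_left (by omega : 0 < d) (by omega)
          · rintro h
            rw [h]
            omega
      · rw [add_zero, card_eq_zero, filter_eq_empty_iff]
        intro τ _ h
        have hmod : j % d = N % d := by rw [← h, Nat.mul_add_mod]
        rcases lt_or_ge j d with hj | hj
        · rw [Nat.mod_eq_of_lt hj] at hmod
          exact h2 hmod
        · have := Nat.mod_eq_sub_mod hj
          rw [Nat.mod_eq_of_lt (by omega : j - d < d)] at this
          omega
      · rfl
    have hcard : #{σ : Fin (n + 1) → Fin m | digitValue m d (n + 1) σ = N} =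
        ∑ j : Fin m, #{τ : Fin n → Fin m | d * digitValue m d n τ + j = N} := by
      simp only [card_filter]
      rw [← (Fin.snocEquiv fun _ => Fin m).sum_comp, Fintype.sum_prod_type]
      refine sum_congr rfl fun j _ => sum_congr rfl fun τ _ => ?_
      simp only [Fin.snocEquiv, Equiv.coe_fn_mk, digitValue_snoc]
    have hmod : N % d < d := Nat.mod_lt _ (by omega)
    rw [hcard, Fin.sum_univ_eq_sum_range
      (fun j => #{τ : Fin n → Fin m | d * digitValue m d n τ + j = N}),
      sum_congr rfl (fun j hj => (hstep j).trans (if_pos (mem_range.1 hj))), sum_add_distrib,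
      sum_ite_eq', sum_ite_eq', if_pos (mem_range.2 (by omega)), digitCount]
    congr 1
    simp only [mem_range]
    exact if_congr (by omega) rfl rfl

theorem digitValue_lt {m d : ℕ} (hd : 2 ≤ d) (hm : m ≤ 2 * d - 1) (n : ℕ)
    (σ : Fin n → Fin m) : digitValue m d n σ < 2 * d ^ n := by
  -- Digits are at most `2d - 2`, so the largest value is `2 (dⁿ - 1)`; the sharp form is the one
  -- that passes through the induction.
  have key : digitValue m d n σ + 2 ≤ 2 * d ^ n := by
    induction n with
    | zero => simp [digitValue]
    | succ n ih =>
      have h1 := ih fun i => σ i.succ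
      rw [digitValue_cons]
      have h2 : (σ 0 : ℕ) * d ^ n ≤ (2 * d - 2) * d ^ n :=
        Nat.mul_le_mul_right _ (by have := (σ 0).2; omega)
      have h3 : (2 * d - 2) * d ^ n + 2 * d ^ n = 2 * d ^ (n + 1) := by
        rw [← add_mul, show 2 * d - 2 + 2 = 2 * d by omega, pow_succ]
        ring
      omega
  omega

theorem wordMap_zero_eq {m d : ℕ} (hd : 2 ≤ d) (n : ℕ) (σ : Fin n → Fin m) :
    wordMap m d n σ 0 =
      ((d : ℝ) - 1) / ((m : ℝ) - 1) / (d : ℝ) ^ n * (digitValue m d n σ : ℝ) := by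
  have hd0 : (d : ℝ) ≠ 0 := by positivity
  induction n with
  | zero => simp [wordMap, digitValue]
  | succ n ih =>
    rw [wordMap, Function.comp_apply, ih, contraction, digitValue_cons]
    push_cast
    field_simp
    ring

/-! ### Pairs of consecutive representation counts -/

/-- Sum of `F` over the pairs of consecutive representation counts at level `n`. -/
def pairSum (m d n : ℕ) (F : ℕ → ℕ → ℝ) : ℝ :=
  ∑ q ∈ range (2 * d ^ n), F (digitCount m d n q) (prev (digitCount m d n) q)

theorem sum_range_mul_eq (d K : ℕ) (G : ℕ → ℝ) :
    ∑ x ∈ range (d * K), G x = ∑ q ∈ range K, ∑ i ∈ range d, G (d * q + i) := by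
  induction K with
  | zero => simp
  | succ K ih => rw [mul_add, mul_one, sum_range_add, ih, sum_range_succ]

theorem pairSum_succ {m d : ℕ} (hd : 2 ≤ d) (hdm : d < m) (hm : m ≤ 2 * d - 1) (n : ℕ)
    (F : ℕ → ℕ → ℝ) :
    pairSum m d (n + 1) F = pairSum m d n fun u v => F (u + v) v + F u (u + v) +
      ((m : ℝ) - d - 1) * F (u + v) (u + v) + (2 * d - 1 - m) * F u u := by
  -- `ρ = m - d - 1` and `κ = 2d - 1 - m` are the multiplicities of the diagonal pairs `(u + v, u +
  -- v)` and `(u, u)` in a block.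
  obtain ⟨ρ, rfl⟩ : ∃ ρ, m = d + ρ + 1 := ⟨m - d - 1, by omega⟩
  obtain ⟨κ, rfl⟩ : ∃ κ, d = ρ + 1 + κ + 1 := ⟨d - ρ - 2, by omega⟩
  generalize hdd : ρ + 1 + κ + 1 = d at *
  have hd0 : 0 < d := by omega
  have hcount : ∀ q i, i < d → digitCount (d + ρ + 1) d (n + 1) (d * q + i) =
      digitCount (d + ρ + 1) d n q +
        if i < ρ + 1 then prev (digitCount (d + ρ + 1) d n) q else 0 := by
    intro q i hi
    have h1 : (d * q + i) / d = q := by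
      rw [Nat.mul_add_div hd0, Nat.div_eq_of_lt hi, add_zero]
    have h2 : (d * q + i) % d = i := by rw [Nat.mul_add_mod, Nat.mod_eq_of_lt hi]
    rw [digitCount, h1, h2, show d + ρ + 1 - d = ρ + 1 by omega]
  -- The last residue `d - 1` is at least `m - d`, so the block before `d * q` ends in an unmodified
  -- count.
  have hprev : ∀ q, prev (digitCount (d + ρ + 1) d (n + 1)) (d * q) =
      prev (digitCount (d + ρ + 1) d n) q := by
    rintro (_ | q)
    · rfl
    · rw [show d * (q + 1) = d * q + (d - 1) + 1 by rw [mul_add]; omega, prev,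
        hcount _ _ (by omega), if_neg (by omega), add_zero, prev]
  unfold pairSum
  rw [pow_succ, ← mul_assoc, mul_comm, sum_range_mul_eq]
  refine sum_congr rfl fun q _ => ?_
  set u := digitCount (d + ρ + 1) d n q
  set v := prev (digitCount (d + ρ + 1) d n) q
  have hrange : range d = range (ρ + 1 + κ + 1) := by rw [hdd]
  rw [hrange, sum_range_succ', sum_range_add, sum_range_succ]
  have e0 : digitCount (d + ρ + 1) d (n + 1) (d * q + 0) = u + v := by
    rw [hcount _ _ hd0, if_pos (by omega)]
  have e1 : ∀ i ∈ range ρ, F (digitCount (d + ρ + 1) d (n + 1) (d * q + (i + 1)))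
      (prev (digitCount (d + ρ + 1) d (n + 1)) (d * q + (i + 1))) = F (u + v) (u + v) := by
    intro i hi
    rw [mem_range] at hi
    rw [hcount _ _ (by omega), if_pos (by omega), ← add_assoc, prev, hcount _ _ (by omega),
      if_pos (by omega)]
  have e2 : ∀ i ∈ range κ, F (digitCount (d + ρ + 1) d (n + 1) (d * q + (ρ + 1 + i + 1)))
      (prev (digitCount (d + ρ + 1) d (n + 1)) (d * q + (ρ + 1 + i + 1))) = F u u := by
    intro i hi
    rw [mem_range] at hi
    rw [hcount _ _ (by omega), if_neg (by omega), ← add_assoc, prev, hcount _ _ (by omega),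
      if_neg (by omega)]
    rfl
  have e3 : F (digitCount (d + ρ + 1) d (n + 1) (d * q + (ρ + 1)))
      (prev (digitCount (d + ρ + 1) d (n + 1)) (d * q + (ρ + 1))) = F u (u + v) := by
    rw [hcount _ _ (by omega), if_neg (by omega), ← add_assoc, prev, hcount _ _ (by omega),
      if_pos (by omega), add_zero]
  have e4 : prev (digitCount (d + ρ + 1) d (n + 1)) (d * q + 0) = v := hprev q
  have hcast : (d : ℝ) = ρ + 1 + κ + 1 := by
    rw [← hdd]
    push_cast
    rfl
  rw [sum_congr rfl e1, sum_congr rfl e2, sum_const, sum_const, card_range, card_range, e0, e3, e4,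
    nsmul_eq_mul, nsmul_eq_mul]
  push_cast
  rw [hcast]
  ring

/-- The range up to `2 * d ^ n` reaches one place past the last possible value, hence the boundary
pair `(0, 1)`. -/
theorem pairSum_zero (m d : ℕ) (F : ℕ → ℕ → ℝ) : pairSum m d 0 F = F 1 0 + F 0 1 := by
  simp [pairSum, sum_range_succ, digitCount, prev]

theorem pairSum_add (m d n : ℕ) (F G : ℕ → ℕ → ℝ) :
    pairSum m d n (fun u v => F u v + G u v) = pairSum m d n F + pairSum m d n G :=
  sum_add_distrib

theorem pairSum_mul_left (m d n : ℕ) (c : ℝ) (F : ℕ → ℕ → ℝ) :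
    pairSum m d n (fun u v => c * F u v) = c * pairSum m d n F := (mul_sum ..).symm

theorem pairSum_fst_and_snd {m d : ℕ} (hd : 2 ≤ d) (hdm : d < m) (hm : m ≤ 2 * d - 1) (n : ℕ) :
    pairSum m d n (fun u _ => (u : ℝ)) = (m : ℝ) ^ n ∧
      pairSum m d n (fun _ v => (v : ℝ)) = (m : ℝ) ^ n := by
  induction n with
  | zero => simp [pairSum_zero]
  | succ n ih =>
    obtain ⟨h1, h2⟩ := ih
    simp only [pairSum_succ hd hdm hm, Nat.cast_add, pairSum_add, pairSum_mul_left, h1, h2]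
    constructor <;> ring

/-- A sum over the nodes of level `n` is a sum over the representation counts. -/
theorem sum_nodes_eq {m d : ℕ} (hd : 2 ≤ d) (hdm : d < m) (hm : m ≤ 2 * d - 1) (n : ℕ)
    (f : ℕ → ℝ) (hf : f 0 = 0) :
    ∑ z ∈ nodes m d n, f (#(wordsTo m d n z)) = pairSum m d n fun u _ => f u := by
  classical
  set κ : ℝ := ((d : ℝ) - 1) / ((m : ℝ) - 1) / (d : ℝ) ^ n
  have hκ : κ ≠ 0 := by
    have h1 : (2 : ℝ) ≤ d := by exact_mod_cast hd
    have h2 : (d : ℝ) < m := by exact_mod_cast hdm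
    have h3 : (0 : ℝ) < (d : ℝ) - 1 := by linarith
    have h4 : (0 : ℝ) < (m : ℝ) - 1 := by linarith
    positivity
  have hinj : Function.Injective fun N : ℕ => κ * (N : ℝ) := fun a b h => by
    exact_mod_cast mul_left_cancel₀ hκ h
  have hnodes : nodes m d n =
      (univ.image (digitValue m d n)).image fun N : ℕ => κ * (N : ℝ) := by
    rw [image_image, nodes]
    congr 1
    ext σ
    exact wordMap_zero_eq hd n σ
  have hwords : ∀ N : ℕ, #(wordsTo m d n (κ * N)) = digitCount m d n N := by
    intro N
    rw [← card_digitValue_eq hd hdm hm, wordsTo]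
    congr 1
    ext σ
    simp only [mem_filter, mem_univ, true_and]
    rw [wordMap_zero_eq hd n σ]
    exact ⟨fun h => hinj h, fun h => by rw [h]⟩
  rw [hnodes, sum_image fun a _ b _ h => hinj h]
  simp only [hwords]
  refine sum_subset ?_ ?_
  · intro N hN
    obtain ⟨σ, -, rfl⟩ := mem_image.1 hN
    exact mem_range.2 (digitValue_lt hd hm n σ)
  · intro N _ hN
    have : digitCount m d n N = 0 := by
      rw [← card_digitValue_eq hd hdm hm, card_eq_zero, filter_eq_empty_iff]
      intro σ _ h
      exact hN (mem_image.2 ⟨σ, mem_univ _, h⟩)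
    rw [this, hf]

/-! ### The generating function of the entropies -/

/-- `∑ a log₂ a` over the representation counts `a` at level `n`. -/
def countEntropy (m d n : ℕ) : ℝ := pairSum m d n fun u _ => xlog u

/-- `∑ (u + v) log₂ (u + v)` over the consecutive representation counts `u, v` at level `n`. -/
def pairCountEntropy (m d n : ℕ) : ℝ := pairSum m d n fun u v => xlog ((u : ℝ) + v)

/-- `∑ (s u + t v) log₂ (s u + t v)` over the consecutive representation counts `u, v` at
level `n` and the ordered coprime pairs `s, t` of Euclidean depth `e`. -/
def treePairEntropy (m d n e : ℕ) : ℝ :=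
  pairSum m d n fun u v => treeSum e fun s t => xlog ((s : ℝ) * u + t * v)

theorem treeSum_xlog_mul (e : ℕ) (w : ℝ) :
    treeSum e (fun s t => xlog ((s : ℝ) * w + t * w)) =
      2 * 3 ^ e * xlog w + euclidSum (e + 1) * w := by
  have h : (fun s t : ℕ => xlog ((s : ℝ) * w + t * w)) =
      fun s t : ℕ => xlog w * ((s : ℝ) + t) + w * xlog ((s : ℝ) + t) := by
    ext s t
    rw [← add_mul, xlog_mul]
    ring
  rw [h, treeSum_add, treeSum_mul_left, treeSum_mul_left, treeSum_fst_add_snd, ← euclidSum_succ]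
  ring

/-- The pairs `(u + v, v)` and `(u, u + v)` recombine through `branch` into tree level `e + 1`; the
diagonal pairs are evaluated by `treeSum_xlog_mul`. The factor `m - 3` is `2(m - d - 1) + (2d - 1 -
m)`. -/
theorem treePairEntropy_succ {m d : ℕ} (hd : 2 ≤ d) (hdm : d < m) (hm : m ≤ 2 * d - 1)
    (n e : ℕ) :
    treePairEntropy m d (n + 1) e = treePairEntropy m d n (e + 1) +
      2 * 3 ^ e * (((m : ℝ) - d - 1) * pairCountEntropy m d n +
        (2 * d - 1 - m) * countEntropy m d n) +
      (m : ℝ) ^ n * (m - 3) * euclidSum (e + 1) := by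
  obtain ⟨hu, hv⟩ := pairSum_fst_and_snd hd hdm hm n
  rw [treePairEntropy, pairSum_succ hd hdm hm]
  have hF : (fun u v : ℕ => treeSum e (fun s t => xlog ((s : ℝ) * (u + v : ℕ) + t * v)) +
      treeSum e (fun s t => xlog ((s : ℝ) * u + t * (u + v : ℕ))) +
      ((m : ℝ) - d - 1) * treeSum e (fun s t => xlog ((s : ℝ) * (u + v : ℕ) + t * (u + v : ℕ))) +
      (2 * d - 1 - m) * treeSum e (fun s t => xlog ((s : ℝ) * u + t * u))) =
      fun u v : ℕ => treeSum (e + 1) (fun s t => xlog ((s : ℝ) * u + t * v)) +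
        (((2 * 3 ^ e * (m - d - 1)) * xlog ((u : ℝ) + v) +
          (2 * 3 ^ e * (2 * d - 1 - m)) * xlog u) +
        ((euclidSum (e + 1) * (d - 2)) * (u : ℝ) +
          (euclidSum (e + 1) * (m - d - 1)) * (v : ℝ))) := by
    ext u v
    rw [treeSum_xlog_mul, treeSum_xlog_mul, treeSum_succ, ← treeSum_add]
    have : branch (fun s t : ℕ => xlog ((s : ℝ) * u + t * v)) =
        fun s t : ℕ => xlog ((s : ℝ) * (u + v : ℕ) + t * v) +
          xlog ((s : ℝ) * u + t * (u + v : ℕ)) := by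
      ext s t
      simp only [branch, Nat.cast_add]
      congr 2 <;> ring
    rw [this]
    push_cast
    ring
  rw [hF]
  simp only [pairSum_add, pairSum_mul_left, hu, hv]
  rw [treePairEntropy, pairCountEntropy, countEntropy]
  ring

theorem treePairEntropy_zero_left (m d e : ℕ) :
    treePairEntropy m d 0 e = 2 * ∑ k ∈ range (e + 1), euclidSum k := by
  rw [← treeSum_xlog_fst_add_snd, treePairEntropy, pairSum_zero, ← treeSum_add]
  simp

theorem treePairEntropy_eq {m d : ℕ} (hd : 2 ≤ d) (hdm : d < m) (hm : m ≤ 2 * d - 1)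
    (n e : ℕ) :
    treePairEntropy m d n e = 2 * ∑ k ∈ range (e + n + 1), euclidSum k +
      ∑ j ∈ range n, (2 * 3 ^ (e + n - 1 - j) * (((m : ℝ) - d - 1) * pairCountEntropy m d j +
        (2 * d - 1 - m) * countEntropy m d j) +
      (m : ℝ) ^ j * (m - 3) * euclidSum (e + n - j)) := by
  induction n generalizing e with
  | zero => simp [treePairEntropy_zero_left]
  | succ n ih =>
    rw [treePairEntropy_succ hd hdm hm, ih, sum_range_succ _ n,
      show e + (n + 1) - 1 - n = e by omega, show e + (n + 1) - n = e + 1 by omega,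
      show e + 1 + n = e + (n + 1) by omega]
    ring

theorem countEntropy_zero (m d : ℕ) : countEntropy m d 0 = 0 := by
  simp [countEntropy, pairSum_zero]

theorem countEntropy_succ {m d : ℕ} (hd : 2 ≤ d) (hdm : d < m) (hm : m ≤ 2 * d - 1) (n : ℕ) :
    countEntropy m d (n + 1) =
      ((m : ℝ) - d) * pairCountEntropy m d n + (2 * d - m) * countEntropy m d n := by
  simp only [countEntropy, pairCountEntropy, pairSum_succ hd hdm hm, pairSum_add,
    pairSum_mul_left, Nat.cast_add]
  ring

theorem pairCountEntropy_eq {m d : ℕ} (hd : 2 ≤ d) (hdm : d < m) (hm : m ≤ 2 * d - 1) (n : ℕ) :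
    pairCountEntropy m d n = 2 * ∑ k ∈ range (n + 1), euclidSum k +
      (∑ j ∈ range n, 2 * 3 ^ (n - 1 - j) * (((m : ℝ) - d - 1) * pairCountEntropy m d j +
        (2 * d - 1 - m) * countEntropy m d j) +
      ∑ j ∈ range (n + 1), (m : ℝ) ^ j * (m - 3) * euclidSum (n - j)) := by
  have h := treePairEntropy_eq hd hdm hm n 0
  simp only [zero_add] at h
  -- The extra term `j = n` vanishes with `euclidSum 0`; it completes the sum to a Cauchy product.
  rw [sum_range_succ (fun j => (m : ℝ) ^ j * (m - 3) * euclidSum (n - j)), Nat.sub_self,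
    euclidSum_zero, mul_zero, add_zero, ← sum_add_distrib, ← h, treePairEntropy]
  simp [treeSum_zero, pairCountEntropy]

/-! ### Formal generating functions -/

/-- The geometric series `∑ cⁿ Xⁿ`. -/
def geom (c : ℝ) : PowerSeries ℝ := PowerSeries.mk fun n => c ^ n

theorem geom_mul (c : ℝ) : geom c * (1 - PowerSeries.C c * PowerSeries.X) = 1 := by
  have h : geom c = PowerSeries.rescale c (PowerSeries.mk 1) := by
    ext n
    simp [geom]
  have h2 := congrArg (PowerSeries.rescale c) (PowerSeries.mk_one_mul_one_sub_eq_one ℝ)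
  rw [map_mul, map_sub, map_one, PowerSeries.rescale_X] at h2
  rw [h]
  exact h2

theorem mk_countEntropy_eq {m d : ℕ} (hd : 2 ≤ d) (hdm : d < m) (hm : m ≤ 2 * d - 1) :
    PowerSeries.mk (countEntropy m d) = PowerSeries.X *
      (PowerSeries.C ((m : ℝ) - d) * PowerSeries.mk (pairCountEntropy m d) +
        PowerSeries.C (2 * (d : ℝ) - m) * PowerSeries.mk (countEntropy m d)) := by
  ext n
  rcases n with _ | n
  · simp [countEntropy_zero]
  · rw [PowerSeries.coeff_succ_X_mul, PowerSeries.coeff_mk, countEntropy_succ hd hdm hm, map_add,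
      PowerSeries.coeff_C_mul, PowerSeries.coeff_C_mul, PowerSeries.coeff_mk,
      PowerSeries.coeff_mk]

theorem mk_pairCountEntropy_eq {m d : ℕ} (hd : 2 ≤ d) (hdm : d < m) (hm : m ≤ 2 * d - 1) :
    PowerSeries.mk (pairCountEntropy m d) =
      PowerSeries.C 2 * (PowerSeries.mk euclidSum * geom 1) +
      PowerSeries.C 2 * (PowerSeries.X * ((PowerSeries.C ((m : ℝ) - d - 1) *
        PowerSeries.mk (pairCountEntropy m d) +
        PowerSeries.C (2 * (d : ℝ) - 1 - m) * PowerSeries.mk (countEntropy m d)) * geom 3)) +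
      PowerSeries.C ((m : ℝ) - 3) * (geom m * PowerSeries.mk euclidSum) := by
  ext n
  rw [PowerSeries.coeff_mk, pairCountEntropy_eq hd hdm hm, ← add_assoc, map_add, map_add]
  congr 1
  · congr 1
    · rw [PowerSeries.coeff_C_mul, PowerSeries.coeff_mul,
        Nat.sum_antidiagonal_eq_sum_range_succ_mk]
      simp [geom]
    · rcases n with _ | n
      · simp
      · rw [PowerSeries.coeff_C_mul, PowerSeries.coeff_succ_X_mul, PowerSeries.coeff_mul,
          Nat.sum_antidiagonal_eq_sum_range_succ_mk, mul_sum]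
        refine sum_congr rfl fun j _ => ?_
        simp only [geom, map_add, PowerSeries.coeff_C_mul, PowerSeries.coeff_mk,
          Nat.add_sub_cancel]
        ring
  · rw [PowerSeries.coeff_C_mul, PowerSeries.coeff_mul,
      Nat.sum_antidiagonal_eq_sum_range_succ_mk, mul_sum]
    refine sum_congr rfl fun j _ => ?_
    simp only [geom, PowerSeries.coeff_mk]
    ring

theorem mk_ell : PowerSeries.mk ell = (1 - 3 * PowerSeries.X) ^ 2 * PowerSeries.mk euclidSum := by
  ext n
  rw [PowerSeries.coeff_mk, ell]

/-- The generating function of `countEntropy`, in terms of that of `ell`. -/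
theorem mk_countEntropy_eq_mk_ell {m d : ℕ} (hd : 2 ≤ d) (hdm : d < m) (hm : m ≤ 2 * d - 1) :
    PowerSeries.mk (countEntropy m d) =
      PowerSeries.C (((m : ℝ) - d) * (m - 1)) * PowerSeries.X * PowerSeries.mk ell *
        (geom m * geom m) * (geom 1 * geom 1) := by
  have hA := mk_countEntropy_eq hd hdm hm
  have hY := mk_pairCountEntropy_eq hd hdm hm
  have g1 := geom_mul 1
  have g3 := geom_mul 3
  have gm := geom_mul m
  have c3 : (PowerSeries.C 3 : PowerSeries ℝ) = 3 := map_ofNat _ 3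
  have c2 : (PowerSeries.C 2 : PowerSeries ℝ) = 2 := map_ofNat _ 2
  rw [mk_ell]
  simp only [map_sub, map_mul, map_one, c2, c3, one_mul] at hA hY g1 g3 gm ⊢
  generalize (PowerSeries.mk (countEntropy m d) : PowerSeries ℝ) = A at *
  generalize (PowerSeries.mk (pairCountEntropy m d) : PowerSeries ℝ) = Y at *
  generalize (PowerSeries.mk euclidSum : PowerSeries ℝ) = E at *
  generalize (PowerSeries.X : PowerSeries ℝ) = X at *
  generalize (PowerSeries.C (m : ℝ) : PowerSeries ℝ) = μ at *
  generalize (PowerSeries.C (d : ℝ) : PowerSeries ℝ) = δ at *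
  generalize geom 1 = G1 at *
  generalize geom 3 = G3 at *
  generalize geom m = Gm at *
  have hY' : (1 - X) * (1 - 3 * X) * (1 - μ * X) * Y = 2 * E * (1 - 3 * X) * (1 - μ * X) +
      2 * X * ((μ - δ - 1) * Y + (2 * δ - 1 - μ) * A) * (1 - X) * (1 - μ * X) +
      (μ - 3) * E * (1 - X) * (1 - 3 * X) := by
    linear_combination (1 - X) * (1 - 3 * X) * (1 - μ * X) * hY +
      2 * E * (1 - 3 * X) * (1 - μ * X) * g1 +
      2 * X * ((μ - δ - 1) * Y + (2 * δ - 1 - μ) * A) * (1 - X) * (1 - μ * X) * g3 +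
      (μ - 3) * E * (1 - X) * (1 - 3 * X) * gm
  -- Eliminating `Y`: the source terms combine by `2(1 - μX) + (μ - 3)(1 - X) = (μ - 1)(1 - 3X)`,
  -- which supplies the second factor `1 - 3X`, and the determinant of the linear system is `(1 -
  -- X)(1 - μX)`.
  have hfin : (1 - μ * X) ^ 2 * (1 - X) ^ 2 * A =
      (μ - δ) * (μ - 1) * X * ((1 - 3 * X) ^ 2 * E) := by
    linear_combination (μ - δ) * X * hY' +
      (1 - X) * (1 - μ * X) * ((1 - 3 * X) - 2 * X * (μ - δ - 1)) * hA
  have hone : (Gm * Gm) * (G1 * G1) * ((1 - μ * X) ^ 2 * (1 - X) ^ 2) = 1 := by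
    calc _ = (Gm * (1 - μ * X)) ^ 2 * (G1 * (1 - X)) ^ 2 := by ring
      _ = 1 := by rw [gm, g1]; ring
  calc A = (Gm * Gm) * (G1 * G1) * ((1 - μ * X) ^ 2 * (1 - X) ^ 2 * A) := by
        rw [← mul_assoc, hone, one_mul]
    _ = _ := by rw [hfin]; ring

theorem uniformLevelEntropy_eq {m d : ℕ} (hd : 2 ≤ d) (hdm : d < m) (hm : m ≤ 2 * d - 1)
    (n : ℕ) : uniformLevelEntropy m d n =
      n * Real.logb 2 m - countEntropy m d n / (m : ℝ) ^ n := by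
  have hm0 : (m : ℝ) ≠ 0 := by
    have : m ≠ 0 := by omega
    exact_mod_cast this
  have hw : ∀ z, weight m d (fun _ => 1 / (m : ℝ)) n z =
      (#(wordsTo m d n z) : ℝ) / (m : ℝ) ^ n := by
    intro z
    simp [weight, div_eq_mul_inv]
  have hterm : ∀ a : ℕ, (a : ℝ) / (m : ℝ) ^ n * Real.logb 2 ((a : ℝ) / (m : ℝ) ^ n) =
      ((m : ℝ) ^ n)⁻¹ * xlog a + (-(n * Real.logb 2 m) * ((m : ℝ) ^ n)⁻¹) * a := by
    intro a
    rcases eq_or_ne a 0 with rfl | ha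
    · simp
    · rw [Real.logb_div (by exact_mod_cast ha) (pow_ne_zero _ hm0), Real.logb_pow, xlog]
      ring
  rw [uniformLevelEntropy, levelEntropy]
  simp only [hw]
  rw [sum_nodes_eq hd hdm hm n
    (fun a => (a : ℝ) / (m : ℝ) ^ n * Real.logb 2 ((a : ℝ) / (m : ℝ) ^ n)) (by simp)]
  simp only [hterm, pairSum_add, pairSum_mul_left, (pairSum_fst_and_snd hd hdm hm n).1]
  rw [countEntropy]
  field_simp
  ring

/-! ### Evaluation of power series -/

/-- The real power series `f` converges absolutely at the complex number `y`, with sum `v`. -/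
def HasAbsSum (f : PowerSeries ℝ) (y v : ℂ) : Prop :=
  Summable (fun n => ‖((PowerSeries.coeff n f : ℝ) : ℂ) * y ^ n‖) ∧
    HasSum (fun n => ((PowerSeries.coeff n f : ℝ) : ℂ) * y ^ n) v

theorem HasAbsSum.mul {f g : PowerSeries ℝ} {y v w : ℂ} (hf : HasAbsSum f y v)
    (hg : HasAbsSum g y w) : HasAbsSum (f * g) y (v * w) := by
  have e : ∀ n, ((PowerSeries.coeff n (f * g) : ℝ) : ℂ) * y ^ n =
      ∑ q ∈ antidiagonal n, (((PowerSeries.coeff q.1 f : ℝ) : ℂ) * y ^ q.1) *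
        (((PowerSeries.coeff q.2 g : ℝ) : ℂ) * y ^ q.2) := by
    intro n
    rw [PowerSeries.coeff_mul, Complex.ofReal_sum, sum_mul]
    refine sum_congr rfl fun q hq => ?_
    rw [← mem_antidiagonal.1 hq, pow_add, Complex.ofReal_mul]
    ring
  have hs := summable_norm_sum_mul_antidiagonal_of_summable_norm hf.1 hg.1
  have h := tsum_mul_tsum_eq_tsum_sum_antidiagonal_of_summable_norm hf.1 hg.1
  rw [hf.2.tsum_eq, hg.2.tsum_eq] at h
  unfold HasAbsSum
  simp only [e]
  rw [h]
  exact ⟨hs, hs.of_norm.hasSum⟩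

theorem hasAbsSum_C (c : ℝ) (y : ℂ) : HasAbsSum (PowerSeries.C c) y c := by
  have h : ∀ n ∉ ({0} : Finset ℕ),
      ((PowerSeries.coeff n (PowerSeries.C c) : ℝ) : ℂ) * y ^ n = 0 := by
    intro n hn
    rw [PowerSeries.coeff_C, if_neg (by simpa using hn)]
    simp
  refine ⟨summable_of_ne_finset_zero fun n hn => by rw [h n hn, norm_zero], ?_⟩
  simpa using hasSum_sum_of_ne_finset_zero h

theorem hasAbsSum_X (y : ℂ) : HasAbsSum PowerSeries.X y y := by
  have h : ∀ n ∉ ({1} : Finset ℕ),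
      ((PowerSeries.coeff n (PowerSeries.X : PowerSeries ℝ) : ℝ) : ℂ) * y ^ n = 0 := by
    intro n hn
    rw [PowerSeries.coeff_X, if_neg (by simpa using hn)]
    simp
  refine ⟨summable_of_ne_finset_zero fun n hn => by rw [h n hn, norm_zero], ?_⟩
  simpa using hasSum_sum_of_ne_finset_zero h

theorem hasAbsSum_geom {c : ℝ} {y : ℂ} (h : ‖(c : ℂ) * y‖ < 1) :
    HasAbsSum (geom c) y (1 - c * y)⁻¹ := by
  have e : ∀ n, ((PowerSeries.coeff n (geom c) : ℝ) : ℂ) * y ^ n = (c * y) ^ n := by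
    intro n
    rw [geom, PowerSeries.coeff_mk, Complex.ofReal_pow, mul_pow]
  unfold HasAbsSum
  simp only [e]
  exact ⟨by simpa only [norm_pow] using summable_geometric_of_lt_one (norm_nonneg _) h,
    hasSum_geometric_of_norm_lt_one h⟩

theorem hasAbsSum_mk_ell {y : ℂ} (hy : ‖y‖ < 1) : HasAbsSum (PowerSeries.mk ell) y (L y) := by
  obtain ⟨C, hC⟩ := exists_abs_ell_le
  unfold HasAbsSum
  simp only [PowerSeries.coeff_mk]
  have hs : Summable fun n => ‖(ell n : ℂ) * y ^ n‖ := by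
    refine Summable.of_nonneg_of_le (fun n => norm_nonneg _) (fun n => ?_)
      ((summable_geometric_of_lt_one (norm_nonneg y) hy).mul_left C)
    rw [norm_mul, norm_pow, Complex.norm_real, Real.norm_eq_abs]
    exact mul_le_mul_of_nonneg_right (hC n) (by positivity)
  exact ⟨hs, hs.of_norm.hasSum⟩

theorem analyticOnNhd_L : AnalyticOnNhd ℂ L (Metric.ball 0 1) := by
  obtain ⟨C, hC⟩ := exists_abs_ell_le
  refine DifferentiableOn.analyticOnNhd (fun z hz => ?_) Metric.isOpen_ball
  rw [mem_ball_zero_iff] at hz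
  -- A smaller disk around `0` containing `z` has the summable majorant `C ρⁿ`.
  obtain ⟨ρ, hzρ, hρ⟩ := exists_between hz
  have hρ0 : 0 ≤ ρ := (norm_nonneg z).trans hzρ.le
  have hdiff : DifferentiableOn ℂ L (Metric.ball 0 ρ) := by
    refine Complex.differentiableOn_tsum_of_summable_norm
      (u := fun n => C * ρ ^ n) ((summable_geometric_of_lt_one hρ0 hρ).mul_left C)
      (fun n => (by fun_prop)) Metric.isOpen_ball fun n w hw => ?_
    rw [mem_ball_zero_iff] at hw
    rw [norm_mul, norm_pow, Complex.norm_real, Real.norm_eq_abs]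
    exact mul_le_mul (hC n) (pow_le_pow_left₀ (norm_nonneg _) hw.le n) (by positivity)
      ((abs_nonneg _).trans (hC n))
  exact (hdiff.differentiableAt
    (Metric.isOpen_ball.mem_nhds (mem_ball_zero_iff.2 hzρ))).differentiableWithinAt

theorem analyticOnNhd_T {m d : ℕ} (hm : 0 < m) :
    AnalyticOnNhd ℂ (T m d) (Metric.ball (0 : ℂ) (m : ℝ)) := by
  intro x hx
  rw [mem_ball_zero_iff] at hx
  have hm0 : (0 : ℝ) < m := by exact_mod_cast hm
  have h1 : (m : ℂ) - x ≠ 0 := by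
    intro h
    rw [← sub_eq_zero.1 h, Complex.norm_natCast] at hx
    exact lt_irrefl _ hx
  have hL : AnalyticAt ℂ (fun x : ℂ => L (x / m)) x := by
    refine AnalyticAt.fun_comp (g := L) (analyticOnNhd_L _ ?_) (analyticAt_id.div_const)
    rw [mem_ball_zero_iff, norm_div, Complex.norm_natCast, div_lt_one hm0]
    exact hx
  have hR : AnalyticAt ℂ (R m d) x :=
    analyticAt_const.div ((analyticAt_const.sub analyticAt_id).pow 2) (pow_ne_zero 2 h1)
  exact analyticAt_const.sub (hR.mul hL)

theorem hasSum_uniformLevelEntropy {m d : ℕ} (hd : 2 ≤ d) (hdm : d < m) (hm : m ≤ 2 * d - 1)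
    {x : ℂ} (hx : ‖x‖ < 1) :
    HasSum (fun n : ℕ => (uniformLevelEntropy m d n : ℂ) * x ^ n)
      (x / (x - 1) ^ 2 * T m d x) := by
  have hm1 : (1 : ℝ) < m := by
    have : 1 < m := by omega
    exact_mod_cast this
  have hmC : (m : ℂ) ≠ 0 := by
    have : m ≠ 0 := by omega
    exact_mod_cast this
  have hxm : ‖x / m‖ < 1 := by
    rw [norm_div, Complex.norm_natCast, div_lt_one (by linarith)]
    linarith
  have hmx : ((m : ℝ) : ℂ) * (x / m) = x := by
    rw [Complex.ofReal_natCast]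
    field_simp
  -- Dividing `countEntropy` by `mⁿ` means evaluating at `x / m`; this factor is the one that needs
  -- `‖x‖ < 1`, the others only `‖x‖ < m`.
  have gm := hasAbsSum_geom (c := m) (y := x / m) (by rw [hmx]; exact hx)
  have g1 := hasAbsSum_geom (c := 1) (y := x / m) (by simpa using hxm)
  have hA := ((((hasAbsSum_C (((m : ℝ) - d) * (m - 1)) (x / m)).mul (hasAbsSum_X _)).mul
    (hasAbsSum_mk_ell hxm)).mul (gm.mul gm)).mul (g1.mul g1)
  rw [← mk_countEntropy_eq_mk_ell hd hdm hm, hmx] at hA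
  have hlog := (hasSum_coe_mul_geometric_of_norm_lt_one hx).mul_left ((Real.logb 2 m : ℝ) : ℂ)
  have h := hlog.sub hA.2
  have hx1 : 1 - x ≠ 0 := by
    intro h0
    rw [← sub_eq_zero.1 h0, norm_one] at hx
    exact lt_irrefl _ hx
  have hmx1 : (m : ℂ) - x ≠ 0 := by
    intro h0
    rw [← sub_eq_zero.1 h0, Complex.norm_natCast] at hx
    linarith
  have hterm : ∀ n : ℕ, (uniformLevelEntropy m d n : ℂ) * x ^ n =
      ((Real.logb 2 m : ℝ) : ℂ) * ((n : ℂ) * x ^ n) -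
        ((PowerSeries.coeff n (PowerSeries.mk (countEntropy m d)) : ℝ) : ℂ) * (x / m) ^ n := by
    intro n
    rw [uniformLevelEntropy_eq hd hdm hm, PowerSeries.coeff_mk]
    push_cast
    rw [div_pow]
    ring
  simp only [hterm]
  suffices hval : _ = x / (x - 1) ^ 2 * T m d x from hval ▸ h
  have e1 : 1 - ((1 : ℝ) : ℂ) * (x / m) = (m - x) / m := by
    rw [Complex.ofReal_one]
    field_simp
  have e2 : (x - 1) ^ 2 = (1 - x) ^ 2 := by ring
  rw [e1, e2]
  unfold T R
  push_cast
  field_simp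

end

end CantorLike

theorem theorem3p2 (m d : ℕ) (hd : 2 ≤ d) (hdm : d < m) (hm : m ≤ 2 * d - 1) :
    (∀ x : ℂ, ‖x‖ < 1 → Summable fun n : ℕ => (CantorLike.ell n : ℂ) * x ^ n) ∧
    AnalyticOnNhd ℂ (CantorLike.T m d) (Metric.ball (0 : ℂ) (m : ℝ)) ∧
    ∀ x : ℂ, ‖x‖ < 1 →
      HasSum (fun n : ℕ => (CantorLike.uniformLevelEntropy m d n : ℂ) * x ^ n)
        (x / (x - 1) ^ 2 * CantorLike.T m d x) := by
  refine ⟨fun x hx => ?_, CantorLike.analyticOnNhd_T (by omega),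
    fun x hx => CantorLike.hasSum_uniformLevelEntropy hd hdm hm hx⟩
  simpa only [PowerSeries.coeff_mk] using (CantorLike.hasAbsSum_mk_ell hx).2.summable
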